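/- **Conventions.** Euclidean spaces are finite-dimensional real inner product spaces. For a linear map $g:V\to W$ between Euclidean spaces let $s_1(g)\ge s_2(g)\ge\dots$ be its singular values, i.e. the square roots of the $\dim V$ eigenvalues of $g^*g$ counted with multiplicity (with $s_2(g)=0$ if $\dim V=1$); $\|g\|=s_1(g)$ is the operator norm. We say that $g$ has a first singular gap if $s_1(g)>s_2(g)$ (in particular $g\ne0$; then $g^*$ has one too), and put $\sigma(g)=s_2(g)/s_1(g)$. In that case $\overline{\mathfrak v}(g)\in\mathbb P(V)$ denotes the most expanding direction of $g$, i.e. the line $\ker(g^*g-s_1(g)^2)$. For $\hat u,\hat v\in\mathbb P(V)$ with unit representatives $u,v$ let $d(\hat u,\hat v)=\min\{\|u-v\|,\|u+v\|\}$ and $\alpha(\hat u,\hat v)=|\langle u,v\rangle|$. For $g:U\to V$ and $g':V\to W$ with first singular gaps let $\alpha(g,g')=\alpha(\overline{\mathfrak v}(g^*),\overline{\mathfrak v}(g'))$. **Theorem 4.1 (Avalanche Principle).** There exist universal constants $c>0$ and $C>0$ with the following property. Let $0<\varepsilon<1$, $0<\kappa\le c\,\varepsilon^2$, $n\ge1$,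 and let $g_j:V_j\to V_{j+1}$, $0\le j\le n-1$, be a chain of linear maps between Euclidean spaces, each having a first singular gap, such that (a) $\sigma(g_i)\le\kappa$ for $0\le i\le n-1$, and (b) $\alpha(g_{i-1},g_i)\ge\varepsilon$ for $1\le i\le n-1$. Let $g^{(n)}=g_{n-1}\cdots g_1g_0$. Then $g^{(n)}$ has a first singular gap, and (1) $d\big(\overline{\mathfrak v}(g^{(n)}),\overline{\mathfrak v}(g_0)\big)\le C\,\kappa\,\varepsilon^{-1}$; (2) $d\big(\overline{\mathfrak v}(g^{(n)*}),\overline{\mathfrak v}(g_{n-1}^*)\big)\le C\,\kappa\,\varepsilon^{-1}$; (3) $\sigma(g^{(n)})\le\left(\dfrac{\kappa\,(4+2\varepsilon)}{\varepsilon^2}\right)^n$; (4) if $n\ge2$, then $$\Big|\log\|g^{(n)}\|+\sum_{i=1}^{n-2}\log\|g_i\|-\sum_{i=1}^{n-1}\log\|g_i\,g_{i-1}\|\Big|\le C\,n\,\frac{\kappa}{\varepsilon^2}.$$ -/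

import Mathlib

open scoped LinearAlgebra.Projectivization

namespace Avalanche

section LinearMaps

variable {V W : Type*}
  [NormedAddCommGroup V] [InnerProductSpace ℝ V] [FiniteDimensional ℝ V]
  [NormedAddCommGroup W] [InnerProductSpace ℝ W] [FiniteDimensional ℝ W]

/-- The operator norm `‖g‖` of a linear map between Euclidean spaces. -/
noncomputable def opNorm (g : V →ₗ[ℝ] W) : ℝ := ‖LinearMap.toContinuousLinearMap g‖

/-- `σ(g) = s₂(g) / s₁(g)`, the inverse of the first gap ratio. Singular values are indexed from `0`,
and those of index at least `dim V` are `0`. -/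
noncomputable def invGapRatio (g : V →ₗ[ℝ] W) : ℝ :=
  g.singularValues 1 / g.singularValues 0

/-- `g` has a first singular gap: `s₁(g) > s₂(g)`. In particular `g ≠ 0`. -/
def HasFirstGap (g : V →ₗ[ℝ] W) : Prop := g.singularValues 1 < g.singularValues 0

theorem HasFirstGap.pos {g : V →ₗ[ℝ] W} (h : HasFirstGap g) : 0 < g.singularValues 0 :=
  (g.singularValues_nonneg 1).trans_lt h

theorem finrank_pos_of_singularValues_pos {g : V →ₗ[ℝ] W} {k : ℕ}
    (h : 0 < g.singularValues k) : k < Module.finrank ℝ V := by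
  by_contra hk
  rw [g.singularValues_of_finrank_le (not_lt.mp hk)] at h
  exact lt_irrefl _ h

/-- The eigenspace of `g* g` for the eigenvalue `s₁(g)²`. -/
noncomputable def topSingularSpace (g : V →ₗ[ℝ] W) : Submodule ℝ V :=
  Module.End.eigenspace (LinearMap.adjoint g ∘ₗ g) (g.singularValues 0 ^ 2)

theorem finrank_eigenspace_adjoint_comp_self (g : V →ₗ[ℝ] W) (c : ℝ) :
    Module.finrank ℝ (Module.End.eigenspace (LinearMap.adjoint g ∘ₗ g) c) =
      (Finset.univ.filter fun i : Fin (Module.finrank ℝ V) => g.singularValues i ^ 2 = c).card := by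
  have := g.isSymmetric_adjoint_comp_self.card_filter_eigenvalues_eq rfl c
  rw [← this]
  congr 1
  ext i
  simp [g.sq_singularValues_fin rfl i]

/-- If `g` has a first singular gap then `s₁(g)` is a simple singular value. -/
theorem HasFirstGap.finrank_topSingularSpace {g : V →ₗ[ℝ] W} (h : HasFirstGap g) :
    Module.finrank ℝ (topSingularSpace g) = 1 := by
  rw [topSingularSpace, finrank_eigenspace_adjoint_comp_self, Finset.card_eq_one]
  refine ⟨⟨0, finrank_pos_of_singularValues_pos h.pos⟩, ?_⟩
  ext i
  simp only [Finset.mem_filter, Finset.mem_univ, true_and, Finset.mem_singleton]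
  constructor
  · intro hi
    have h1 : g.singularValues i = g.singularValues 0 :=
      (sq_eq_sq₀ (g.singularValues_nonneg _) (g.singularValues_nonneg _)).mp hi
    by_contra hne
    have h2 : 1 ≤ (i : ℕ) := by
      rcases Nat.eq_zero_or_pos (i : ℕ) with h0 | h0
      · exact absurd (Fin.ext h0) hne
      · exact h0
    have h3 := g.singularValues_antitone h2
    have h4 : g.singularValues 1 < g.singularValues 0 := h
    linarith
  · rintro rfl
    rfl

theorem finrank_eigenspace_le_adjoint (g : V →ₗ[ℝ] W) {c : ℝ} (hc : c ≠ 0) :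
    Module.finrank ℝ (Module.End.eigenspace (LinearMap.adjoint g ∘ₗ g) c) ≤
      Module.finrank ℝ (Module.End.eigenspace (g ∘ₗ LinearMap.adjoint g) c) := by
  have hmaps : ∀ x ∈ Module.End.eigenspace (LinearMap.adjoint g ∘ₗ g) c,
      g x ∈ Module.End.eigenspace (g ∘ₗ LinearMap.adjoint g) c := by
    intro x hx
    rw [Module.End.mem_eigenspace_iff] at hx ⊢
    have : LinearMap.adjoint g (g x) = c • x := hx
    simp [this]
  refine LinearMap.finrank_le_finrank_of_injective (f := g.restrict hmaps) ?_
  rw [← LinearMap.ker_eq_bot, LinearMap.ker_eq_bot']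
  rintro ⟨x, hx⟩ h0
  have h1 : g x = 0 := congrArg Subtype.val h0
  rw [Module.End.mem_eigenspace_iff] at hx
  have h2 : LinearMap.adjoint g (g x) = c • x := hx
  rw [h1, map_zero] at h2
  have h3 : x = 0 := (smul_eq_zero.mp h2.symm).resolve_left hc
  exact Subtype.ext h3

theorem finrank_eigenspace_adjoint (g : V →ₗ[ℝ] W) {c : ℝ} (hc : c ≠ 0) :
    Module.finrank ℝ (Module.End.eigenspace
        (LinearMap.adjoint (LinearMap.adjoint g) ∘ₗ LinearMap.adjoint g) c) =
      Module.finrank ℝ (Module.End.eigenspace (LinearMap.adjoint g ∘ₗ g) c) := by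
  have h1 := finrank_eigenspace_le_adjoint g hc
  have h2 := finrank_eigenspace_le_adjoint (LinearMap.adjoint g) hc
  rw [LinearMap.adjoint_adjoint] at h2 ⊢
  exact le_antisymm h2 h1

theorem singularValues_zero_le_adjoint (g : V →ₗ[ℝ] W) (h : 0 < g.singularValues 0) :
    g.singularValues 0 ≤ (LinearMap.adjoint g).singularValues 0 := by
  have hc : g.singularValues 0 ^ 2 ≠ 0 := (pow_pos h 2).ne'
  have h1 := finrank_eigenspace_adjoint g hc
  rw [finrank_eigenspace_adjoint_comp_self, finrank_eigenspace_adjoint_comp_self] at h1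
  have h2 : 0 < (Finset.univ.filter fun i : Fin (Module.finrank ℝ V) =>
      g.singularValues i ^ 2 = g.singularValues 0 ^ 2).card := by
    refine Finset.card_pos.mpr ⟨⟨0, finrank_pos_of_singularValues_pos h⟩, ?_⟩
    simp
  rw [← h1] at h2
  obtain ⟨i, hi⟩ := Finset.card_pos.mp h2
  simp only [Finset.mem_filter, Finset.mem_univ, true_and] at hi
  rw [← (sq_eq_sq₀ ((LinearMap.adjoint g).singularValues_nonneg _)
    (g.singularValues_nonneg _)).mp hi]
  exact (LinearMap.adjoint g).singularValues_antitone (Nat.zero_le _)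

/-- The adjoint of a map with a first singular gap has a first singular gap. -/
theorem HasFirstGap.adjoint {g : V →ₗ[ℝ] W} (h : HasFirstGap g) :
    HasFirstGap (LinearMap.adjoint g) := by
  have hle := singularValues_zero_le_adjoint g h.pos
  have hpos : 0 < (LinearMap.adjoint g).singularValues 0 := h.pos.trans_le hle
  have hge := singularValues_zero_le_adjoint (LinearMap.adjoint g) hpos
  rw [LinearMap.adjoint_adjoint] at hge
  have heq : g.singularValues 0 = (LinearMap.adjoint g).singularValues 0 := le_antisymm hle hge
  have hc : g.singularValues 0 ^ 2 ≠ 0 := (pow_pos h.pos 2).ne'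
  have h1 := finrank_eigenspace_adjoint g hc
  have h2 := h.finrank_topSingularSpace
  rw [topSingularSpace] at h2
  rw [h2, finrank_eigenspace_adjoint_comp_self] at h1
  by_contra hcon
  have hs : (LinearMap.adjoint g).singularValues 1 = (LinearMap.adjoint g).singularValues 0 :=
    le_antisymm ((LinearMap.adjoint g).singularValues_antitone (Nat.zero_le 1)) (not_lt.mp hcon)
  have hd : 1 < Module.finrank ℝ W :=
    finrank_pos_of_singularValues_pos (g := LinearMap.adjoint g) (hs ▸ hpos)
  obtain ⟨a, ha⟩ := Finset.card_eq_one.mp h1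
  have m0 : (⟨0, by omega⟩ : Fin (Module.finrank ℝ W)) ∈ ({a} : Finset _) := by
    rw [← ha]; simp [heq]
  have m1 : (⟨1, hd⟩ : Fin (Module.finrank ℝ W)) ∈ ({a} : Finset _) := by
    rw [← ha]; simp [heq, hs]
  rw [Finset.mem_singleton] at m0 m1
  have := m0.trans m1.symm
  simp at this

/-- The `g`-most expanding direction: the singular direction associated with the simple singular
value `s₁(g)`, as a point of the projective space. -/
noncomputable def mostExpandingDirection (g : V →ₗ[ℝ] W) (h : HasFirstGap g) : ℙ ℝ V :=
  Projectivization.mk'' (topSingularSpace g) h.finrank_topSingularSpace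

/-- `α(p, q) = |⟪u, v⟫| / (‖u‖ ‖v‖)` for representatives `u` of `p` and `v` of `q`. -/
noncomputable def projAngle (p q : ℙ ℝ V) : ℝ :=
  |inner ℝ p.rep q.rep| / (‖p.rep‖ * ‖q.rep‖)

/-- The projective distance `d(p, q) = min (‖u - v‖, ‖u + v‖)` for unit representatives
`u` of `p` and `v` of `q`. -/
noncomputable def projDist (p q : ℙ ℝ V) : ℝ :=
  min ‖‖p.rep‖⁻¹ • p.rep - ‖q.rep‖⁻¹ • q.rep‖ ‖‖p.rep‖⁻¹ • p.rep + ‖q.rep‖⁻¹ • q.rep‖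

end LinearMaps

/-- The angle `α(g, g') = α(v(g*), v(g'))` between two composable maps `g : U → V`, `g' : V → W`
with first singular gaps, where `v` denotes the most expanding direction. -/
noncomputable def mapAngle {U V W : Type*}
    [NormedAddCommGroup U] [InnerProductSpace ℝ U] [FiniteDimensional ℝ U]
    [NormedAddCommGroup V] [InnerProductSpace ℝ V] [FiniteDimensional ℝ V]
    [NormedAddCommGroup W] [InnerProductSpace ℝ W] [FiniteDimensional ℝ W]
    (g : U →ₗ[ℝ] V) (g' : V →ₗ[ℝ] W) (h : HasFirstGap g) (h' : HasFirstGap g') : ℝ :=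
  projAngle (mostExpandingDirection (LinearMap.adjoint g) h.adjoint) (mostExpandingDirection g' h')

/-- The composition `g⁽ⁱ⁾ = g_{i-1} ⋯ g₁ g₀` of the first `i` maps of a chain `g_j : V_j → V_{j+1}`. -/
noncomputable def chainProd {V : ℕ → Type*}
    [∀ j, NormedAddCommGroup (V j)] [∀ j, InnerProductSpace ℝ (V j)]
    (g : ∀ j, V j →ₗ[ℝ] V (j + 1)) : ∀ i, V 0 →ₗ[ℝ] V i
  | 0 => LinearMap.id
  | i + 1 => g i ∘ₗ chainProd g i

end Avalanche

/-! Each map `g i` has unit vectors `v i`, `u i` with `g i (v i) = s i • u i`, and is smaller by a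
factor `κ` on the complement of `v i`. The invariant is `IsDominant Q v δ`: on the complement of
`v`, `Q` is at most `δ * ‖Q v‖`. By `IsDominant.comp` it survives precomposition by a gap map with
the same `δ = 2κ/ε`, so nothing deteriorates with the length of the chain. Hence the product is
dominated by `v 0` and its adjoint by `u m`, which locates both top directions
(`IsDominant.projDist_le`).

Dominance also gives `‖Q u‖ ≈ |⟪u, v⟫| ‖Q v‖`, so each factor multiplies the norm by nearly `s i`
times an angle. Two-fold products obey the same formula; the angles cancel in the logarithms and the
errors, of order `κ/ε²` per step, add up.

The gap comes from areas: a gap map expands parallelograms by at most `κ s²`, so the product has `s₁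
s₂ ≤ κⁿ ∏ sₖ²`, whereas the norm estimate gives `s₁ ≥ ∏ sₖ (ε/2)ⁿ⁻¹`. Dividing by `s₁²` bounds
`s₂/s₁`. -/

namespace Avalanche

set_option linter.unusedSectionVars false

/-! ### Singular vectors and gap pairs -/

section SingularValues

variable {V W : Type*}
  [NormedAddCommGroup V] [InnerProductSpace ℝ V] [FiniteDimensional ℝ V]
  [NormedAddCommGroup W] [InnerProductSpace ℝ W] [FiniteDimensional ℝ W]

/-- An orthonormal basis of right singular vectors. -/
theorem exists_singular_basis (g : V →ₗ[ℝ] W) :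
    ∃ b : OrthonormalBasis (Fin (Module.finrank ℝ V)) ℝ V,
      ∀ i, LinearMap.adjoint g (g (b i)) = (g.singularValues i ^ 2) • b i := by
  refine ⟨g.isSymmetric_adjoint_comp_self.eigenvectorBasis rfl, fun i => ?_⟩
  have h := g.isSymmetric_adjoint_comp_self.apply_eigenvectorBasis rfl i
  rw [← g.sq_singularValues_fin rfl i] at h
  exact h

theorem norm_sq_map_eq_sum (g : V →ₗ[ℝ] W)
    (b : OrthonormalBasis (Fin (Module.finrank ℝ V)) ℝ V)
    (hb : ∀ i, LinearMap.adjoint g (g (b i)) = (g.singularValues i ^ 2) • b i) (x : V) :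
    ‖g x‖ ^ 2 = ∑ i : Fin (Module.finrank ℝ V), g.singularValues i ^ 2 * inner ℝ x (b i) ^ 2 := by
  have h1 : ‖g x‖ ^ 2 = inner ℝ (LinearMap.adjoint g (g x)) x := by
    rw [LinearMap.adjoint_inner_left, real_inner_self_eq_norm_sq]
  rw [h1, ← b.sum_inner_mul_inner]
  refine Finset.sum_congr rfl fun i _ => ?_
  rw [LinearMap.adjoint_inner_left, ← LinearMap.adjoint_inner_right, hb, inner_smul_right,
    real_inner_comm x (b i)]
  ring

theorem norm_sq_eq_sum (b : OrthonormalBasis (Fin (Module.finrank ℝ V)) ℝ V) (x : V) :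
    ‖x‖ ^ 2 = ∑ i, inner ℝ x (b i) ^ 2 := by
  rw [← real_inner_self_eq_norm_sq, ← b.sum_inner_mul_inner]
  refine Finset.sum_congr rfl fun i _ => ?_
  rw [real_inner_comm x (b i)]
  ring

theorem norm_map_le_singularValues_zero (g : V →ₗ[ℝ] W) (x : V) :
    ‖g x‖ ≤ g.singularValues 0 * ‖x‖ := by
  obtain ⟨b, hb⟩ := exists_singular_basis g
  refine (pow_le_pow_iff_left₀ (norm_nonneg _) (mul_nonneg (g.singularValues_nonneg 0) (norm_nonneg x)) two_ne_zero).mp ?_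
  rw [mul_pow, norm_sq_map_eq_sum g b hb, norm_sq_eq_sum b, Finset.mul_sum]
  refine Finset.sum_le_sum fun i _ => ?_
  have h1 := g.singularValues_antitone (Nat.zero_le i)
  have h2 := g.singularValues_nonneg i
  gcongr

/-- Given a first singular gap, `g` sends the unit singular vector `v` to `s • u`, with `u` a unit
singular vector of the adjoint, and it is bounded by `κ s` on the orthogonal complement of `v`. -/
structure IsGapPair (g : V →ₗ[ℝ] W) (v : V) (u : W) (s κ : ℝ) : Prop where
  norm_left : ‖v‖ = 1
  norm_right : ‖u‖ = 1
  pos : 0 < s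
  nonneg : 0 ≤ κ
  le_one : κ ≤ 1
  map_eq : g v = s • u
  adjoint_eq : LinearMap.adjoint g u = s • v
  bound : ∀ w, inner ℝ w v = 0 → ‖g w‖ ≤ κ * s * ‖w‖

theorem IsGapPair.mono {g : V →ₗ[ℝ] W} {v : V} {u : W} {s κ κ' : ℝ}
    (h : IsGapPair g v u s κ) (hκ : κ ≤ κ') (h1 : κ' ≤ 1) : IsGapPair g v u s κ' where
  norm_left := h.norm_left
  norm_right := h.norm_right
  pos := h.pos
  nonneg := h.nonneg.trans hκ
  le_one := h1
  map_eq := h.map_eq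
  adjoint_eq := h.adjoint_eq
  bound w hw := (h.bound w hw).trans (by have := h.pos; gcongr)

theorem IsGapPair.adjoint {g : V →ₗ[ℝ] W} {v : V} {u : W} {s κ : ℝ}
    (h : IsGapPair g v u s κ) : IsGapPair (LinearMap.adjoint g) u v s κ where
  norm_left := h.norm_right
  norm_right := h.norm_left
  pos := h.pos
  nonneg := h.nonneg
  le_one := h.le_one
  map_eq := h.adjoint_eq
  adjoint_eq := by rw [LinearMap.adjoint_adjoint, h.map_eq]
  -- The adjoint sends the complement of `u` into that of `v`; then `‖g* z‖² = ⟪z, g g* z⟫` is at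
  -- most `‖z‖ * κ s ‖g* z‖`, and one factor cancels.
  bound z hz := by
    have h1 : inner ℝ (LinearMap.adjoint g z) v = 0 := by
      rw [LinearMap.adjoint_inner_left, h.map_eq, inner_smul_right, hz, mul_zero]
    have h2 := h.bound _ h1
    have h3 : ‖LinearMap.adjoint g z‖ ^ 2 ≤ ‖z‖ * ‖g (LinearMap.adjoint g z)‖ := by
      rw [← real_inner_self_eq_norm_sq, LinearMap.adjoint_inner_left]
      exact real_inner_le_norm _ _
    rcases (norm_nonneg (LinearMap.adjoint g z)).eq_or_lt with h0 | h0
    · rw [← h0]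
      exact mul_nonneg (mul_nonneg h.nonneg h.pos.le) (norm_nonneg z)
    · have h4 := mul_le_mul_of_nonneg_left h2 (norm_nonneg z)
      refine le_of_mul_le_mul_right ?_ h0
      nlinarith

theorem IsGapPair.inner_map_eq_zero {g : V →ₗ[ℝ] W} {v : V} {u : W} {s κ : ℝ}
    (h : IsGapPair g v u s κ) {w : V} (hw : inner ℝ w v = 0) : inner ℝ (g w) u = 0 := by
  rw [← LinearMap.adjoint_inner_right, h.adjoint_eq, inner_smul_right, hw, mul_zero]

/-- Splitting off the component along a unit vector. -/
theorem exists_orthogonal_decomp {v : V} (hv : ‖v‖ = 1) (x : V) :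
    ∃ w, inner ℝ w v = 0 ∧ x = (inner ℝ x v : ℝ) • v + w ∧
      ‖x‖ ^ 2 = (inner ℝ x v : ℝ) ^ 2 + ‖w‖ ^ 2 := by
  have hvv : inner ℝ v v = (1 : ℝ) := by rw [real_inner_self_eq_norm_sq, hv]; norm_num
  refine ⟨x - (inner ℝ x v : ℝ) • v, ?_, by abel, ?_⟩
  · rw [inner_sub_left, inner_smul_left, hvv]; simp
  · rw [norm_sub_sq_real, norm_smul, hv, inner_smul_right]
    simp only [Real.norm_eq_abs, mul_one, sq_abs]
    ring

theorem IsGapPair.norm_map_le {g : V →ₗ[ℝ] W} {v : V} {u : W} {s κ : ℝ}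
    (h : IsGapPair g v u s κ) (x : V) : ‖g x‖ ≤ s * ‖x‖ := by
  obtain ⟨w, hw, hx, hn⟩ := exists_orthogonal_decomp h.norm_left x
  have h1 : ‖g x‖ ^ 2 = ((inner ℝ x v : ℝ) * s) ^ 2 + ‖g w‖ ^ 2 := by
    conv_lhs => rw [hx]
    rw [map_add, map_smul, h.map_eq, smul_smul, norm_add_sq_real, inner_smul_left,
      real_inner_comm (g w) u, h.inner_map_eq_zero hw, norm_smul, h.norm_right]
    simp only [Real.norm_eq_abs, mul_one, sq_abs, mul_zero, add_zero]
  have h2 : ‖g w‖ ≤ s * ‖w‖ := by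
    refine (h.bound w hw).trans ?_
    have := mul_le_mul_of_nonneg_right h.le_one (mul_nonneg h.pos.le (norm_nonneg w))
    linarith
  have h3 : ‖g w‖ ^ 2 ≤ (s * ‖w‖) ^ 2 := pow_le_pow_left₀ (norm_nonneg _) h2 2
  refine (pow_le_pow_iff_left₀ (norm_nonneg _) (mul_nonneg h.pos.le (norm_nonneg x)) two_ne_zero).mp ?_
  rw [mul_pow, hn, h1]
  nlinarith

theorem opNorm_le {g : V →ₗ[ℝ] W} {M : ℝ} (hM : 0 ≤ M) (h : ∀ x, ‖g x‖ ≤ M * ‖x‖) :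
    opNorm g ≤ M :=
  ContinuousLinearMap.opNorm_le_bound _ hM h

theorem norm_map_le_opNorm (g : V →ₗ[ℝ] W) (x : V) : ‖g x‖ ≤ opNorm g * ‖x‖ :=
  (LinearMap.toContinuousLinearMap g).le_opNorm x

theorem norm_adjoint_map_le (g : V →ₗ[ℝ] W) (z : W) :
    ‖LinearMap.adjoint g z‖ ≤ opNorm g * ‖z‖ := by
  have h3 : ‖LinearMap.adjoint g z‖ ^ 2 ≤ ‖z‖ * ‖g (LinearMap.adjoint g z)‖ := by
    rw [← real_inner_self_eq_norm_sq, LinearMap.adjoint_inner_left]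
    exact real_inner_le_norm _ _
  have h2 := norm_map_le_opNorm g (LinearMap.adjoint g z)
  rcases (norm_nonneg (LinearMap.adjoint g z)).eq_or_lt with h0 | h0
  · rw [← h0]
    exact mul_nonneg (norm_nonneg _) (norm_nonneg z)
  · have h4 := mul_le_mul_of_nonneg_left h2 (norm_nonneg z)
    refine le_of_mul_le_mul_right ?_ h0
    nlinarith

theorem opNorm_adjoint (g : V →ₗ[ℝ] W) : opNorm (LinearMap.adjoint g) = opNorm g := by
  refine le_antisymm (opNorm_le (norm_nonneg _) (norm_adjoint_map_le g))
    (opNorm_le (norm_nonneg _) fun x => ?_)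
  have := norm_adjoint_map_le (LinearMap.adjoint g) x
  rwa [LinearMap.adjoint_adjoint] at this

theorem IsGapPair.opNorm_eq {g : V →ₗ[ℝ] W} {v : V} {u : W} {s κ : ℝ}
    (h : IsGapPair g v u s κ) : opNorm g = s := by
  refine le_antisymm (opNorm_le h.pos.le h.norm_map_le) ?_
  have := norm_map_le_opNorm g v
  rwa [h.map_eq, norm_smul, h.norm_left, h.norm_right, mul_one, mul_one,
    Real.norm_of_nonneg h.pos.le] at this

theorem eq_or_eq_neg_of_finrank_eq_one {S : Submodule ℝ V} (hS : Module.finrank ℝ S = 1)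
    {x y : V} (hx : x ∈ S) (hy : y ∈ S) (hx1 : ‖x‖ = 1) (hy1 : ‖y‖ = 1) : x = y ∨ x = -y := by
  have hy0 : (⟨y, hy⟩ : S) ≠ 0 := fun h0 => by
    rw [show y = 0 from congrArg Subtype.val h0, norm_zero] at hy1
    exact zero_ne_one hy1
  obtain ⟨c, hc⟩ := (finrank_eq_one_iff_of_nonzero' (⟨y, hy⟩ : S) hy0).mp hS ⟨x, hx⟩
  have hc' : c • y = x := congrArg Subtype.val hc
  rw [← hc', norm_smul, hy1, mul_one, Real.norm_eq_abs, abs_eq zero_le_one] at hx1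
  rcases hx1 with rfl | rfl
  · left; rw [← hc', one_smul]
  · right; rw [← hc', neg_one_smul]

/-- Every unit vector of the top singular space belongs to a gap pair. -/
theorem HasFirstGap.isGapPair {g : V →ₗ[ℝ] W} (h : HasFirstGap g) {v : V}
    (hv : v ∈ topSingularSpace g) (hv1 : ‖v‖ = 1) :
    IsGapPair g v ((g.singularValues 0)⁻¹ • g v) (g.singularValues 0) (invGapRatio g) := by
  have hs := h.pos
  have hgg : LinearMap.adjoint g (g v) = (g.singularValues 0 ^ 2) • v :=
    Module.End.mem_eigenspace_iff.mp hv
  have hn : ‖g v‖ = g.singularValues 0 := by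
    have : ‖g v‖ ^ 2 = g.singularValues 0 ^ 2 := by
      rw [← real_inner_self_eq_norm_sq, ← LinearMap.adjoint_inner_left, hgg, inner_smul_left,
        real_inner_self_eq_norm_sq, hv1]
      simp
    exact (sq_eq_sq₀ (norm_nonneg _) hs.le).mp this
  have hmul : invGapRatio g * g.singularValues 0 = g.singularValues 1 :=
    div_mul_cancel₀ _ hs.ne'
  refine ⟨hv1, ?_, hs, div_nonneg (g.singularValues_nonneg 1) hs.le, ?_, ?_, ?_, ?_⟩
  · rw [norm_smul, norm_inv, Real.norm_of_nonneg hs.le, hn, inv_mul_cancel₀ hs.ne']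
  · exact (div_le_one hs).mpr (le_of_lt h)
  · rw [smul_smul, mul_inv_cancel₀ hs.ne', one_smul]
  · rw [map_smul, hgg, smul_smul]
    congr 1
    field_simp
  · intro w hw
    obtain ⟨b, hb⟩ := exists_singular_basis g
    have hd := finrank_pos_of_singularValues_pos hs
    -- The top singular space is a line, so `b 0 = ±v`; `w` then involves only singular values of
    -- index at least `1`.
    have hw0 : inner ℝ w (b ⟨0, hd⟩) = (0 : ℝ) := by
      have hb0 : b ⟨0, hd⟩ ∈ topSingularSpace g :=
        Module.End.mem_eigenspace_iff.mpr (hb ⟨0, hd⟩)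
      rcases eq_or_eq_neg_of_finrank_eq_one h.finrank_topSingularSpace hb0 hv
        (b.orthonormal.1 _) hv1 with h1 | h1
      · rw [h1, hw]
      · rw [h1, inner_neg_right, hw, neg_zero]
    rw [hmul]
    refine (pow_le_pow_iff_left₀ (norm_nonneg _) (mul_nonneg (g.singularValues_nonneg 1) (norm_nonneg w)) two_ne_zero).mp ?_
    rw [mul_pow, norm_sq_map_eq_sum g b hb, norm_sq_eq_sum b, Finset.mul_sum]
    refine Finset.sum_le_sum fun i _ => ?_
    rcases Nat.eq_zero_or_pos (i : ℕ) with hi | hi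
    · rw [show i = ⟨0, hd⟩ from Fin.ext hi, hw0]; simp
    · have h1 := g.singularValues_antitone (Nat.succ_le_of_lt hi)
      have h2 := g.singularValues_nonneg i
      gcongr

theorem IsGapPair.right_mem_topSingularSpace {g : V →ₗ[ℝ] W} {v : V} {u : W} {κ : ℝ}
    (hg : HasFirstGap g) (h : IsGapPair g v u (g.singularValues 0) κ) :
    u ∈ topSingularSpace (LinearMap.adjoint g) := by
  have heq : (LinearMap.adjoint g).singularValues 0 = g.singularValues 0 := by
    have h1 := singularValues_zero_le_adjoint g hg.pos
    have h2 := singularValues_zero_le_adjoint (LinearMap.adjoint g) hg.adjoint.pos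
    rw [LinearMap.adjoint_adjoint] at h2
    exact le_antisymm h2 h1
  rw [topSingularSpace, Module.End.mem_eigenspace_iff, LinearMap.adjoint_adjoint, heq]
  rw [LinearMap.comp_apply, h.adjoint_eq, map_smul, h.map_eq, smul_smul, sq]

/-! ### Areas of parallelograms -/

/-- The Gram determinant of two vectors. -/
def gramDet (x y : V) : ℝ := ‖x‖ ^ 2 * ‖y‖ ^ 2 - (inner ℝ x y : ℝ) ^ 2

theorem gramDet_add_smul (x y : V) (c : ℝ) : gramDet x (y + c • x) = gramDet x y := by
  unfold gramDet
  rw [norm_add_sq_real, inner_add_right, inner_smul_right, inner_smul_right, norm_smul,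
    real_inner_self_eq_norm_sq, real_inner_comm x y, mul_pow, Real.norm_eq_abs, sq_abs]
  ring

/-- Shearing `y` along `x` preserves the Gram determinant, on both sides of `g`. Once the vectors
are orthogonal, the determinant is a product of squared norms, and for the images it is at most that
product. -/
theorem gramDet_map_le_of_bound {g : V →ₗ[ℝ] W} {S : Submodule ℝ V} {K : ℝ}
    (hK : ∀ x ∈ S, ‖g x‖ ≤ K * ‖x‖) {x y : V} (hx : x ∈ S) (hy : y ∈ S) :
    gramDet (g x) (g y) ≤ K ^ 4 * gramDet x y := by
  rcases eq_or_ne x 0 with rfl | hx0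
  · simp [gramDet]
  have hn : ‖x‖ ^ 2 ≠ 0 := pow_ne_zero 2 (norm_ne_zero_iff.mpr hx0)
  set c : ℝ := -(inner ℝ x y / ‖x‖ ^ 2) with hc
  have hz : inner ℝ x (y + c • x) = (0 : ℝ) := by
    rw [inner_add_right, inner_smul_right, real_inner_self_eq_norm_sq, hc]
    field_simp
    ring
  have hzS : y + c • x ∈ S := S.add_mem hy (S.smul_mem c hx)
  rw [← gramDet_add_smul x y c, ← gramDet_add_smul (g x) (g y) c, ← map_smul, ← map_add]
  have h1 : ‖g x‖ ^ 2 ≤ (K * ‖x‖) ^ 2 := pow_le_pow_left₀ (norm_nonneg _) (hK x hx) 2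
  have h2 : ‖g (y + c • x)‖ ^ 2 ≤ (K * ‖y + c • x‖) ^ 2 :=
    pow_le_pow_left₀ (norm_nonneg _) (hK _ hzS) 2
  have h3 := mul_le_mul h1 h2 (sq_nonneg _) (sq_nonneg _)
  have h4 := sq_nonneg (inner ℝ (g x) (g (y + c • x)) : ℝ)
  unfold gramDet
  rw [hz]
  nlinarith

/-- This is Pythagoras for bivectors: `(a u + X) ∧ (b u + Y) = u ∧ (a Y - b X) + X ∧ Y`, with
orthogonal summands. -/
theorem gramDet_smul_add_of_orthogonal {u X Y : V} (hu : ‖u‖ = 1) (hX : inner ℝ X u = (0 : ℝ))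
    (hY : inner ℝ Y u = (0 : ℝ)) (a b : ℝ) :
    gramDet (a • u + X) (b • u + Y) = ‖a • Y - b • X‖ ^ 2 + gramDet X Y := by
  have hX' : inner ℝ u X = (0 : ℝ) := by rw [real_inner_comm, hX]
  have hY' : inner ℝ u Y = (0 : ℝ) := by rw [real_inner_comm, hY]
  unfold gramDet
  rw [norm_add_sq_real, norm_add_sq_real, norm_sub_sq_real]
  simp only [inner_add_left, inner_add_right, inner_smul_left, inner_smul_right, norm_smul,
    real_inner_self_eq_norm_sq, hX, hX', hY', hu, mul_pow, Real.norm_eq_abs, sq_abs,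
    real_inner_comm X Y, conj_trivial]
  ring

/-- Areas containing the direction `v` grow by at most `s * κ s`, those inside its complement by at
most `(κ s)²`, which is no larger because `κ ≤ 1`. -/
theorem IsGapPair.gramDet_map_le {g : V →ₗ[ℝ] W} {v : V} {u : W} {s κ : ℝ}
    (h : IsGapPair g v u s κ) (x y : V) :
    gramDet (g x) (g y) ≤ (κ * s ^ 2) ^ 2 * gramDet x y := by
  obtain ⟨x', hx', hx, -⟩ := exists_orthogonal_decomp h.norm_left x
  obtain ⟨y', hy', hy, -⟩ := exists_orthogonal_decomp h.norm_left y
  set a : ℝ := inner ℝ x v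
  set b : ℝ := inner ℝ y v
  have hb : ∀ w ∈ (ℝ ∙ v)ᗮ, ‖g w‖ ≤ κ * s * ‖w‖ := fun w hw =>
    h.bound w ((real_inner_comm _ _).trans (Submodule.mem_orthogonal_singleton_iff_inner_right.mp hw))
  have mem : ∀ w : V, inner ℝ w v = (0 : ℝ) → w ∈ (ℝ ∙ v)ᗮ := fun w hw =>
    Submodule.mem_orthogonal_singleton_iff_inner_right.mpr ((real_inner_comm _ _).trans hw)
  have h1 := gramDet_map_le_of_bound hb (mem _ hx') (mem _ hy')
  have h2 : ‖g (a • y' - b • x')‖ ≤ κ * s * ‖a • y' - b • x'‖ :=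
    hb _ (Submodule.sub_mem _ (Submodule.smul_mem _ _ (mem _ hy'))
      (Submodule.smul_mem _ _ (mem _ hx')))
  have h3 := pow_le_pow_left₀ (norm_nonneg _) h2 2
  have e1 : gramDet (g x) (g y) = s ^ 2 * ‖g (a • y' - b • x')‖ ^ 2 + gramDet (g x') (g y') := by
    rw [hx, hy, map_add, map_add, map_smul, map_smul, h.map_eq, smul_smul, smul_smul,
      gramDet_smul_add_of_orthogonal h.norm_right (h.inner_map_eq_zero hx')
        (h.inner_map_eq_zero hy'), map_sub, map_smul, map_smul, mul_comm a, mul_comm b,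
      mul_smul, mul_smul, ← smul_sub, norm_smul, mul_pow, Real.norm_eq_abs, sq_abs]
  have e2 : gramDet x y = ‖a • y' - b • x'‖ ^ 2 + gramDet x' y' := by
    rw [hx, hy, gramDet_smul_add_of_orthogonal h.norm_left hx' hy']
  have h4 : 0 ≤ gramDet x' y' := by
    have := pow_le_pow_left₀ (abs_nonneg _) (abs_real_inner_le_norm x' y') 2
    rw [sq_abs, mul_pow] at this
    exact sub_nonneg.mpr this
  have h5 : (κ * s) ^ 4 ≤ (κ * s ^ 2) ^ 2 := by
    have : κ ^ 4 ≤ κ ^ 2 := pow_le_pow_of_le_one h.nonneg h.le_one (by norm_num)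
    have hs := sq_nonneg (s ^ 2)
    nlinarith
  rw [e1, e2]
  have h6 := mul_le_mul_of_nonneg_right h5 h4
  have h7 := mul_le_mul_of_nonneg_left h3 (sq_nonneg s)
  nlinarith

/-- The first two right singular vectors span a unit square whose image is a rectangle with sides
`s₁` and `s₂`. -/
theorem singularValues_zero_mul_one_le {g : V →ₗ[ℝ] W} {M : ℝ} (hM : 0 ≤ M)
    (h : ∀ x y, gramDet (g x) (g y) ≤ M ^ 2 * gramDet x y) :
    g.singularValues 0 * g.singularValues 1 ≤ M := by
  rcases le_or_gt (Module.finrank ℝ V) 1 with hd | hd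
  · rw [g.singularValues_of_finrank_le hd, mul_zero]
    exact hM
  obtain ⟨b, hb⟩ := exists_singular_basis g
  have hn : ∀ i, ‖g (b i)‖ ^ 2 = g.singularValues i ^ 2 := fun i => by
    rw [← real_inner_self_eq_norm_sq, ← LinearMap.adjoint_inner_left, hb, inner_smul_left,
      real_inner_self_eq_norm_sq, b.orthonormal.1]
    simp
  have hne : (⟨0, by omega⟩ : Fin (Module.finrank ℝ V)) ≠ ⟨1, hd⟩ := by simp
  have h1 := h (b ⟨0, by omega⟩) (b ⟨1, hd⟩)
  unfold gramDet at h1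
  rw [hn, hn, ← LinearMap.adjoint_inner_left, hb, inner_smul_left, b.orthonormal.2 hne,
    b.orthonormal.1, b.orthonormal.1] at h1
  refine (pow_le_pow_iff_left₀ (mul_nonneg (g.singularValues_nonneg 0) (g.singularValues_nonneg 1)) hM two_ne_zero).mp ?_
  simpa [mul_pow] using h1

/-! ### Points of the projective space -/

theorem normalize_rep_eq {p : ℙ ℝ V} {x : V} (hx : x ∈ p.submodule) (hx1 : ‖x‖ = 1) :
    ‖p.rep‖⁻¹ • p.rep = x ∨ ‖p.rep‖⁻¹ • p.rep = -x := by
  refine eq_or_eq_neg_of_finrank_eq_one p.finrank_submodule ?_ hx ?_ hx1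
  · rw [p.submodule_eq]
    exact Submodule.smul_mem _ _ (Submodule.mem_span_singleton_self _)
  · rw [norm_smul, norm_inv, norm_norm, inv_mul_cancel₀ (norm_ne_zero_iff.mpr p.rep_nonzero)]

theorem projAngle_eq {p q : ℙ ℝ V} {x y : V} (hx : x ∈ p.submodule) (hx1 : ‖x‖ = 1)
    (hy : y ∈ q.submodule) (hy1 : ‖y‖ = 1) : projAngle p q = |inner ℝ x y| := by
  have h : projAngle p q = |inner ℝ (‖p.rep‖⁻¹ • p.rep) (‖q.rep‖⁻¹ • q.rep)| := by
    rw [inner_smul_left, inner_smul_right, abs_mul, abs_mul, projAngle]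
    simp only [conj_trivial, abs_inv, abs_norm]
    rw [div_eq_mul_inv, mul_inv]
    ring
  rw [h]
  rcases normalize_rep_eq hx hx1 with h1 | h1 <;> rcases normalize_rep_eq hy hy1 with h2 | h2 <;>
    rw [h1, h2] <;> simp

theorem projDist_eq {p q : ℙ ℝ V} {x y : V} (hx : x ∈ p.submodule) (hx1 : ‖x‖ = 1)
    (hy : y ∈ q.submodule) (hy1 : ‖y‖ = 1) : projDist p q = min ‖x - y‖ ‖x + y‖ := by
  unfold projDist
  rcases normalize_rep_eq hx hx1 with h1 | h1 <;> rcases normalize_rep_eq hy hy1 with h2 | h2 <;>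
    rw [h1, h2]
  · rw [sub_neg_eq_add, ← sub_eq_add_neg, min_comm]
  · rw [← norm_neg (-x - y), ← norm_neg (-x + y), min_comm]
    congr 2 <;> abel
  · rw [← norm_neg (-x - -y), ← norm_neg (-x + -y)]
    congr 2 <;> abel

theorem mem_submodule_mostExpandingDirection {g : V →ₗ[ℝ] W} (h : HasFirstGap g) {x : V}
    (hx : x ∈ topSingularSpace g) : x ∈ (mostExpandingDirection g h).submodule := by
  rwa [mostExpandingDirection, Projectivization.submodule_mk'']

theorem HasFirstGap.exists_unit_mem {g : V →ₗ[ℝ] W} (h : HasFirstGap g) :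
    ∃ v ∈ topSingularSpace g, ‖v‖ = 1 := by
  obtain ⟨b, hb⟩ := exists_singular_basis g
  exact ⟨b ⟨0, finrank_pos_of_singularValues_pos h.pos⟩,
    Module.End.mem_eigenspace_iff.mpr (hb _), b.orthonormal.1 _⟩

end SingularValues

/-! ### Dominated directions -/

section Dominant

variable {V W X : Type*}
  [NormedAddCommGroup V] [InnerProductSpace ℝ V] [FiniteDimensional ℝ V]
  [NormedAddCommGroup W] [InnerProductSpace ℝ W] [FiniteDimensional ℝ W]
  [NormedAddCommGroup X] [InnerProductSpace ℝ X] [FiniteDimensional ℝ X]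

/-- `Q` expands `v` much more than it expands the orthogonal complement of `v`. -/
def IsDominant (Q : V →ₗ[ℝ] W) (v : V) (δ : ℝ) : Prop :=
  ∀ w, inner ℝ w v = 0 → ‖Q w‖ ≤ δ * ‖Q v‖ * ‖w‖

theorem IsDominant.mono {Q : V →ₗ[ℝ] W} {v : V} {δ δ' : ℝ} (h : IsDominant Q v δ) (hδ : δ ≤ δ') :
    IsDominant Q v δ' := fun w hw => (h w hw).trans (by gcongr)

theorem IsGapPair.norm_map_left {g : V →ₗ[ℝ] W} {v : V} {u : W} {s κ : ℝ}
    (h : IsGapPair g v u s κ) : ‖g v‖ = s := by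
  rw [h.map_eq, norm_smul, h.norm_right, mul_one, Real.norm_of_nonneg h.pos.le]

theorem IsGapPair.isDominant {g : V →ₗ[ℝ] W} {v : V} {u : W} {s κ : ℝ}
    (h : IsGapPair g v u s κ) : IsDominant g v κ := fun w hw => by
  rw [h.norm_map_left]
  exact h.bound w hw

theorem IsDominant.norm_map_le {Q : V →ₗ[ℝ] W} {v : V} {δ : ℝ} (h : IsDominant Q v δ)
    (hv : ‖v‖ = 1) (hδ : 0 ≤ δ) (x : V) : ‖Q x‖ ≤ (1 + δ) * ‖Q v‖ * ‖x‖ := by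
  obtain ⟨w, hw, hx, hn⟩ := exists_orthogonal_decomp hv x
  have h1 : ‖w‖ ≤ ‖x‖ := (pow_le_pow_iff_left₀ (norm_nonneg _) (norm_nonneg _) two_ne_zero).mp
    (by rw [hn]; linarith [sq_nonneg (inner ℝ x v : ℝ)])
  have h2 : |(inner ℝ x v : ℝ)| ≤ ‖x‖ := by
    simpa [hv] using abs_real_inner_le_norm x v
  calc ‖Q x‖ = ‖(inner ℝ x v : ℝ) • Q v + Q w‖ := by
        conv_lhs => rw [hx, map_add, map_smul]
    _ ≤ |(inner ℝ x v : ℝ)| * ‖Q v‖ + ‖Q w‖ := by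
        refine (norm_add_le _ _).trans ?_
        rw [norm_smul, Real.norm_eq_abs]
    _ ≤ ‖x‖ * ‖Q v‖ + δ * ‖Q v‖ * ‖x‖ := by
        refine add_le_add (by gcongr) ((h w hw).trans (by gcongr))
    _ = _ := by ring

theorem IsDominant.abs_norm_sub_le {Q : V →ₗ[ℝ] W} {v u : V} {δ : ℝ} (h : IsDominant Q v δ)
    (hv : ‖v‖ = 1) (hδ : 0 ≤ δ) (hu : ‖u‖ = 1) :
    |‖Q u‖ - |inner ℝ u v| * ‖Q v‖| ≤ δ * ‖Q v‖ := by
  obtain ⟨w, hw, hx, hn⟩ := exists_orthogonal_decomp hv u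
  have h1 : ‖w‖ ≤ 1 := (pow_le_pow_iff_left₀ (norm_nonneg _) zero_le_one two_ne_zero).mp
    (by rw [hu] at hn; nlinarith [sq_nonneg (inner ℝ u v : ℝ)])
  have h2 : |(inner ℝ u v : ℝ)| * ‖Q v‖ = ‖(inner ℝ u v : ℝ) • Q v‖ := by
    rw [norm_smul, Real.norm_eq_abs]
  rw [h2]
  refine (abs_norm_sub_norm_le _ _).trans ?_
  have h3 : Q u - (inner ℝ u v : ℝ) • Q v = Q w := by
    conv_lhs => rw [hx, map_add, map_smul]
    rw [← hx]
    abel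
  rw [h3]
  refine (h w hw).trans ?_
  have := mul_le_mul_of_nonneg_left h1 (mul_nonneg hδ (norm_nonneg (Q v)))
  linarith

/-- The direction dominated by `g` is also dominated by `Q ∘ g`, as soon as the image direction of
`g` is sufficiently transversal to the orthogonal complement of the direction dominated by `Q`. -/
theorem IsDominant.comp {Q : W →ₗ[ℝ] X} {v' : W} {δ : ℝ} (hQ : IsDominant Q v' δ)
    (hv' : ‖v'‖ = 1) (hδ : 0 ≤ δ) {g : V →ₗ[ℝ] W} {v : V} {u : W} {s κ : ℝ}
    (h : IsGapPair g v u s κ) (hκ : κ * (1 + δ) ≤ δ * (|inner ℝ u v'| - δ)) :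
    IsDominant (Q ∘ₗ g) v δ := fun w hw => by
  have h1 := abs_le.mp (hQ.abs_norm_sub_le hv' hδ h.norm_right)
  rw [LinearMap.comp_apply, LinearMap.comp_apply, h.map_eq, map_smul, norm_smul,
    Real.norm_of_nonneg h.pos.le]
  have hT := norm_nonneg (Q v')
  have hs := mul_nonneg h.pos.le (norm_nonneg w)
  calc ‖Q (g w)‖ ≤ (1 + δ) * ‖Q v'‖ * ‖g w‖ := hQ.norm_map_le hv' hδ _
    _ ≤ (1 + δ) * ‖Q v'‖ * (κ * s * ‖w‖) := by
        have := h.bound w hw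
        gcongr
    _ = (κ * (1 + δ)) * (‖Q v'‖ * (s * ‖w‖)) := by ring
    _ ≤ (δ * (|inner ℝ u v'| - δ)) * (‖Q v'‖ * (s * ‖w‖)) := by gcongr
    _ = δ * ((|inner ℝ u v'| - δ) * ‖Q v'‖) * (s * ‖w‖) := by ring
    _ ≤ δ * ‖Q u‖ * (s * ‖w‖) := by
        gcongr
        linarith
    _ = _ := by ring

theorem IsDominant.abs_norm_comp_sub_le {Q : W →ₗ[ℝ] X} {v' : W} {δ : ℝ} (hQ : IsDominant Q v' δ)
    (hv' : ‖v'‖ = 1) (hδ : 0 ≤ δ) {g : V →ₗ[ℝ] W} {v : V} {u : W} {s κ : ℝ}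
    (h : IsGapPair g v u s κ) :
    |‖(Q ∘ₗ g) v‖ - s * |inner ℝ u v'| * ‖Q v'‖| ≤ δ * (s * ‖Q v'‖) := by
  have h1 := mul_le_mul_of_nonneg_left (hQ.abs_norm_sub_le hv' hδ h.norm_right) h.pos.le
  rw [LinearMap.comp_apply, h.map_eq, map_smul, norm_smul, Real.norm_of_nonneg h.pos.le]
  rw [← abs_of_pos h.pos, ← abs_mul, abs_of_pos h.pos] at h1
  calc _ = |s * (‖Q u‖ - |inner ℝ u v'| * ‖Q v'‖)| := by congr 1; ring
    _ ≤ _ := h1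
    _ = _ := by ring

theorem IsDominant.projDist_le {P : V →ₗ[ℝ] W} {v : V} {δ : ℝ} (h : IsDominant P v δ)
    (hv : ‖v‖ = 1) (hδ : 0 ≤ δ) (hP : HasFirstGap P) {p : ℙ ℝ V} (hp : v ∈ p.submodule) :
    projDist (mostExpandingDirection P hP) p ≤ 2 * δ := by
  obtain ⟨x, hxt, hx1⟩ := hP.exists_unit_mem
  rw [projDist_eq (mem_submodule_mostExpandingDirection hP hxt) hx1 hp hv]
  have hpair := hP.isGapPair hxt hx1
  obtain ⟨w, hw, hx, hn⟩ := exists_orthogonal_decomp hv x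
  have hs := hP.pos
  set s := P.singularValues 0
  set a : ℝ := inner ℝ x v with ha
  have hPv : ‖P v‖ ≤ s := by simpa [hv] using hpair.norm_map_le v
  have h1 : s ≤ s * (|a| + δ * ‖w‖) := by
    calc s = ‖a • P v + P w‖ := by
          rw [← hpair.norm_map_left]
          conv_lhs => rw [hx, map_add, map_smul]
      _ ≤ |a| * ‖P v‖ + δ * ‖P v‖ * ‖w‖ := by
          refine (norm_add_le _ _).trans (add_le_add ?_ (h w hw))
          rw [norm_smul, Real.norm_eq_abs]
      _ = ‖P v‖ * (|a| + δ * ‖w‖) := by ring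
      _ ≤ s * (|a| + δ * ‖w‖) := by gcongr
  have h2 : 1 ≤ |a| + δ * ‖w‖ := by
    refine le_of_mul_le_mul_left ?_ hs
    rwa [mul_one]
  -- From `1 - |a| ≤ δ ‖w‖` and `‖w‖² = (1 - |a|)(1 + |a|)` follows `‖w‖ ≤ 2δ`, hence `2 - 2|a| ≤
  -- 4δ²`, with no smallness of `δ`.
  have h3 : |a| ≤ 1 := by simpa [hv, hx1] using abs_real_inner_le_norm x v
  have h4 : ‖w‖ ≤ 2 * δ := by
    rcases (norm_nonneg w).eq_or_lt with h0 | h0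
    · rw [← h0]; linarith
    · refine le_of_mul_le_mul_right ?_ h0
      rw [hx1, ← sq_abs a] at hn
      have := abs_nonneg a
      nlinarith
  have h5 : 1 - |a| ≤ 2 * δ ^ 2 := by nlinarith [mul_le_mul_of_nonneg_left h4 hδ]
  have e1 : ‖x - v‖ ^ 2 = 2 - 2 * a := by
    rw [norm_sub_sq_real, hx1, hv, ← ha]; ring
  have e2 : ‖x + v‖ ^ 2 = 2 + 2 * a := by
    rw [norm_add_sq_real, hx1, hv, ← ha]; ring
  rcases le_total 0 a with h0 | h0
  · refine (min_le_left _ _).trans ?_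
    refine (pow_le_pow_iff_left₀ (norm_nonneg _) (by linarith) two_ne_zero).mp ?_
    rw [abs_of_nonneg h0] at h5
    rw [e1]; linarith
  · refine (min_le_right _ _).trans ?_
    refine (pow_le_pow_iff_left₀ (norm_nonneg _) (by linarith) two_ne_zero).mp ?_
    rw [abs_of_nonpos h0] at h5
    rw [e2]; linarith

theorem norm_map_le_opNorm_of_unit (Q : V →ₗ[ℝ] W) {v : V} (hv : ‖v‖ = 1) :
    ‖Q v‖ ≤ opNorm Q := by
  simpa [hv] using norm_map_le_opNorm Q v

theorem IsDominant.abs_log_opNorm_sub_le {Q : V →ₗ[ℝ] W} {v : V} {δ : ℝ} (h : IsDominant Q v δ)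
    (hv : ‖v‖ = 1) (hδ : 0 ≤ δ) (hQ : 0 < ‖Q v‖) :
    |Real.log (opNorm Q) - Real.log ‖Q v‖| ≤ δ := by
  have h1 := norm_map_le_opNorm_of_unit Q hv
  have h2 : opNorm Q ≤ (1 + δ) * ‖Q v‖ := opNorm_le (by positivity) (h.norm_map_le hv hδ)
  have h3 := Real.log_le_log hQ h1
  have h4 := Real.log_le_log (hQ.trans_le h1) h2
  rw [Real.log_mul (by positivity) hQ.ne'] at h4
  have h5 := Real.log_le_sub_one_of_pos (show 0 < 1 + δ by linarith)
  rw [abs_le]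
  constructor <;> linarith

end Dominant

/-! ### From relative errors to logarithms -/

theorem abs_log_le_of_abs_sub_one_le {r t : ℝ} (ht : t ≤ 1 / 2) (h : |r - 1| ≤ t) :
    |Real.log r| ≤ 2 * t := by
  obtain ⟨h1, h2⟩ := abs_le.mp h
  have hr : 0 < r := by linarith
  have h3 := Real.log_le_sub_one_of_pos hr
  have h4 := Real.one_sub_inv_le_log_of_pos hr
  have h5 : r⁻¹ ≤ 1 + 2 * t := by
    rw [inv_le_iff_one_le_mul₀ hr]
    nlinarith
  rw [abs_le]
  constructor <;> linarith

/-- Measured against `s * a * T` the error is `δ / a ≤ δ / ε`; with `δ = 2κ/ε` this is where the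
second power of `ε⁻¹` arises. -/
theorem abs_log_sub_le {A T s a δ ε : ℝ} (hT : 0 < T) (hs : 0 < s) (hε : 0 < ε) (ha : ε ≤ a)
    (hδ : 0 ≤ δ) (hδε : δ ≤ ε / 2) (h : |A - s * a * T| ≤ δ * (s * T)) :
    0 < A ∧ |Real.log A - (Real.log s + Real.log a + Real.log T)| ≤ 2 * (δ / ε) := by
  have ha0 : 0 < a := hε.trans_le ha
  have hD : 0 < s * a * T := by positivity
  have h1 : |A / (s * a * T) - 1| ≤ δ / ε := by
    rw [div_sub_one hD.ne', abs_div, abs_of_pos hD, div_le_div_iff₀ hD hε]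
    have : δ * (s * T) * ε ≤ δ * (s * T) * a := by gcongr
    nlinarith
  have h2 : δ / ε ≤ 1 / 2 := by rw [div_le_iff₀ hε]; linarith
  have hA : 0 < A := by
    have := (abs_le.mp h1).1
    have h3 : 0 < A / (s * a * T) := by linarith
    exact (div_pos_iff_of_pos_right hD).mp h3
  refine ⟨hA, ?_⟩
  have h3 := abs_log_le_of_abs_sub_one_le h2 h1
  rwa [Real.log_div hA.ne' hD.ne', Real.log_mul (by positivity) hT.ne',
    Real.log_mul hs.ne' ha0.ne'] at h3

/-! ### Propagation along the chain -/

section Chain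

variable {V : ℕ → Type*}
  [∀ j, NormedAddCommGroup (V j)] [∀ j, InnerProductSpace ℝ (V j)] [∀ j, FiniteDimensional ℝ (V j)]
  {g : ∀ j, V j →ₗ[ℝ] V (j + 1)} {v : ∀ j, V j} {u : ∀ j, V (j + 1)} {s : ℕ → ℝ}
  {ε κ : ℝ} {m : ℕ}

/-- The hypotheses of the avalanche principle for the maps `g 0, …, g m`, in terms of unit singular
vectors `v j` of `g j` and `u j` of its adjoint, and of `s j = ‖g j‖`. -/
structure IsGapChain (g : ∀ j, V j →ₗ[ℝ] V (j + 1)) (v : ∀ j, V j) (u : ∀ j, V (j + 1))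
    (s : ℕ → ℝ) (ε κ : ℝ) (m : ℕ) : Prop where
  pos : 0 < ε
  lt_one : ε < 1
  nonneg : 0 ≤ κ
  le_sq : κ ≤ 1 / 8 * ε ^ 2
  isGapPair : ∀ i ≤ m, IsGapPair (g i) (v i) (u i) (s i) κ
  le_inner : ∀ i, i + 1 ≤ m → ε ≤ |inner ℝ (u i) (v (i + 1))|

namespace IsGapChain

variable (h : IsGapChain g v u s ε κ m)

include h

theorem two_mul_div_nonneg : 0 ≤ 2 * (κ / ε) :=
  mul_nonneg zero_le_two (div_nonneg h.nonneg h.pos.le)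

theorem two_mul_div_le : 2 * (κ / ε) ≤ ε / 4 := by
  have := h.pos
  have h1 : κ / ε ≤ ε / 8 := by
    rw [div_le_iff₀ this]
    nlinarith [h.le_sq]
  linarith

theorem le_two_mul_div : κ ≤ 2 * (κ / ε) := by
  have h1 : κ ≤ κ / ε := le_div_self h.nonneg h.pos h.lt_one.le
  have := div_nonneg h.nonneg h.pos.le
  linarith

/-- This is the condition of `IsDominant.comp` for `δ = 2κ/ε`. As `δ ≤ ε/4`, the left side is at
most `5κ/4`, and the right side at least `δ * 3ε/4 = 3κ/2`. -/
theorem transversality {a : ℝ} (ha : ε ≤ a) :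
    κ * (1 + 2 * (κ / ε)) ≤ 2 * (κ / ε) * (a - 2 * (κ / ε)) := by
  have h1 := h.two_mul_div_le
  have h2 := h.two_mul_div_nonneg
  have h3 : κ = κ / ε * ε := (div_mul_cancel₀ κ h.pos.ne').symm
  have h4 := h.lt_one
  have h5 : κ * (1 + 2 * (κ / ε)) ≤ κ * (1 + 1 / 4) := by
    have := h.nonneg
    gcongr
    linarith
  have h6 : 2 * (κ / ε) * (ε - ε / 4) ≤ 2 * (κ / ε) * (a - 2 * (κ / ε)) := by
    gcongr
  have h7 := h.nonneg
  nlinarith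

/-- `chainProd` grows on the left while dominance propagates by precomposition; letting `Q` vary
allows `g i` to be absorbed into it. -/
theorem isDominant_comp_chainProd {X : Type*} [NormedAddCommGroup X] [InnerProductSpace ℝ X]
    [FiniteDimensional ℝ X] : ∀ i ≤ m, ∀ Q : V i →ₗ[ℝ] X, IsDominant Q (v i) (2 * (κ / ε)) →
      IsDominant (Q ∘ₗ chainProd g i) (v 0) (2 * (κ / ε))
  | 0, _, Q, hQ => hQ
  | i + 1, hi, Q, hQ =>
    isDominant_comp_chainProd i (by omega) (Q ∘ₗ g i)
      (hQ.comp (h.isGapPair _ hi).norm_left h.two_mul_div_nonneg (h.isGapPair i (by omega))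
        (h.transversality (h.le_inner i hi)))

theorem isDominant_chainProd : IsDominant (chainProd g (m + 1)) (v 0) (2 * (κ / ε)) :=
  h.isDominant_comp_chainProd m le_rfl (g m)
    ((h.isGapPair m le_rfl).isDominant.mono h.le_two_mul_div)

theorem le_inner' (i : ℕ) (hi : i + 1 ≤ m) : ε ≤ |inner ℝ (v (i + 1)) (u i)| := by
  rw [real_inner_comm]
  exact h.le_inner i hi

/-- For adjoints the new map is precomposed, so the induction follows `chainProd` directly. This is
why norms are also tracked on the adjoint side. -/
theorem isDominant_adjoint_chainProd : ∀ i ≤ m,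
    IsDominant (LinearMap.adjoint (chainProd g (i + 1))) (u i) (2 * (κ / ε))
  | 0, hi => (h.isGapPair 0 hi).adjoint.isDominant.mono h.le_two_mul_div
  | i + 1, hi => by
    rw [chainProd, LinearMap.adjoint_comp]
    exact (isDominant_adjoint_chainProd i (by omega)).comp
      (h.isGapPair i (by omega)).norm_right h.two_mul_div_nonneg (h.isGapPair _ hi).adjoint
      (h.transversality (h.le_inner' i hi))

theorem norm_adjoint_chainProd_zero : ‖LinearMap.adjoint (chainProd g (0 + 1)) (u 0)‖ = s 0 :=
  (h.isGapPair 0 (Nat.zero_le m)).adjoint.norm_map_left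

theorem abs_norm_adjoint_chainProd_sub_le (i : ℕ) (hi : i + 1 ≤ m) :
    |‖LinearMap.adjoint (chainProd g (i + 1 + 1)) (u (i + 1))‖ -
        s (i + 1) * |inner ℝ (v (i + 1)) (u i)| * ‖LinearMap.adjoint (chainProd g (i + 1)) (u i)‖|
      ≤ 2 * (κ / ε) * (s (i + 1) * ‖LinearMap.adjoint (chainProd g (i + 1)) (u i)‖) := by
  rw [chainProd, LinearMap.adjoint_comp]
  exact (h.isDominant_adjoint_chainProd i (by omega)).abs_norm_comp_sub_le
    (h.isGapPair i (by omega)).norm_right h.two_mul_div_nonneg (h.isGapPair _ hi).adjoint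

theorem prod_pos : ∀ i ≤ m, 0 < ∏ k ∈ Finset.range (i + 1), s k := fun i hi =>
  Finset.prod_pos fun k hk =>
    (h.isGapPair k (by have := Finset.mem_range.mp hk; omega)).pos

theorem le_norm_adjoint_chainProd : ∀ i ≤ m,
    (∏ k ∈ Finset.range (i + 1), s k) * (ε / 2) ^ i ≤
      ‖LinearMap.adjoint (chainProd g (i + 1)) (u i)‖
  | 0, _ => by
    rw [h.norm_adjoint_chainProd_zero]
    simp
  | i + 1, hi => by
    have h1 := (abs_le.mp (h.abs_norm_adjoint_chainProd_sub_le i hi)).1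
    have h2 := le_norm_adjoint_chainProd i (by omega)
    have hs := (h.isGapPair _ hi).pos
    have hε := h.pos
    have h3 : ε / 2 ≤ |inner ℝ (v (i + 1)) (u i)| - 2 * (κ / ε) := by
      have := h.le_inner' i hi
      have := h.two_mul_div_le
      linarith
    rw [Finset.prod_range_succ, pow_succ]
    calc _ = s (i + 1) * ((∏ k ∈ Finset.range (i + 1), s k) * (ε / 2) ^ i) * (ε / 2) := by ring
      _ ≤ s (i + 1) * ‖LinearMap.adjoint (chainProd g (i + 1)) (u i)‖ *
          (|inner ℝ (v (i + 1)) (u i)| - 2 * (κ / ε)) := by gcongr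
      _ ≤ _ := by linarith

theorem norm_adjoint_chainProd_pos (i : ℕ) (hi : i ≤ m) :
    0 < ‖LinearMap.adjoint (chainProd g (i + 1)) (u i)‖ := by
  refine lt_of_lt_of_le ?_ (h.le_norm_adjoint_chainProd i hi)
  have := h.pos
  exact mul_pos (h.prod_pos i hi) (by positivity)

theorem gramDet_chainProd_le : ∀ i ≤ m + 1, ∀ x y,
    gramDet (chainProd g i x) (chainProd g i y) ≤
      (κ ^ i * (∏ k ∈ Finset.range i, s k) ^ 2) ^ 2 * gramDet x y
  | 0, _, x, y => by simp [chainProd]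
  | i + 1, hi, x, y => by
    have h1 := (h.isGapPair i (by omega)).gramDet_map_le (chainProd g i x) (chainProd g i y)
    have h2 := gramDet_chainProd_le i (by omega) x y
    have h3 := mul_le_mul_of_nonneg_left h2 (sq_nonneg (κ * s i ^ 2))
    refine (h1.trans h3).trans (le_of_eq ?_)
    rw [Finset.prod_range_succ]
    ring

theorem prod_mul_pow_le_singularValues_zero :
    (∏ k ∈ Finset.range (m + 1), s k) * (ε / 2) ^ m ≤ (chainProd g (m + 1)).singularValues 0 := by
  refine (h.le_norm_adjoint_chainProd m le_rfl).trans ?_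
  refine (norm_map_le_opNorm_of_unit _ (h.isGapPair m le_rfl).norm_right).trans ?_
  rw [opNorm_adjoint]
  exact opNorm_le (LinearMap.singularValues_nonneg _ 0) (norm_map_le_singularValues_zero _)

theorem invGapRatio_le :
    0 < (chainProd g (m + 1)).singularValues 0 ∧
      invGapRatio (chainProd g (m + 1)) ≤ (4 * κ / ε ^ 2) ^ (m + 1) := by
  have h1 := h.prod_mul_pow_le_singularValues_zero
  have hP := h.prod_pos m le_rfl
  have hε := h.pos
  have hκ := h.nonneg
  have h2 : (chainProd g (m + 1)).singularValues 0 * (chainProd g (m + 1)).singularValues 1 ≤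
      κ ^ (m + 1) * (∏ k ∈ Finset.range (m + 1), s k) ^ 2 :=
    singularValues_zero_mul_one_le (by positivity) (h.gramDet_chainProd_le (m + 1) le_rfl)
  set s₀ := (chainProd g (m + 1)).singularValues 0
  set P := ∏ k ∈ Finset.range (m + 1), s k
  have hlow : 0 < P * (ε / 2) ^ m := by positivity
  have hs : 0 < s₀ := hlow.trans_le h1
  refine ⟨hs, ?_⟩
  -- One factor `ε / 2 < 1` is given away so that the bound becomes an exact power `m + 1`.
  have h3 : (P * (ε / 2) ^ (m + 1)) ^ 2 ≤ s₀ ^ 2 := by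
    refine pow_le_pow_left₀ (by positivity) (le_trans ?_ h1) 2
    refine mul_le_mul_of_nonneg_left ?_ hP.le
    exact pow_le_pow_of_le_one (by positivity) (by linarith [h.lt_one]) (Nat.le_succ m)
  rw [invGapRatio, div_le_iff₀ hs]
  refine le_of_mul_le_mul_left ?_ hs
  refine h2.trans ?_
  calc κ ^ (m + 1) * P ^ 2 = (4 * κ / ε ^ 2) ^ (m + 1) * (P * (ε / 2) ^ (m + 1)) ^ 2 := by
        rw [mul_pow P, ← pow_mul, mul_comm (m + 1) 2, pow_mul, mul_left_comm, ← mul_pow]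
        rw [mul_comm]
        congr 2
        field_simp
        norm_num
    _ ≤ (4 * κ / ε ^ 2) ^ (m + 1) * s₀ ^ 2 := by gcongr
    _ = _ := by ring

theorem four_mul_div_le : 4 * κ / ε ^ 2 ≤ 1 / 2 := by
  have := h.pos
  rw [div_le_iff₀ (by positivity)]
  linarith [h.le_sq]

theorem hasFirstGap : HasFirstGap (chainProd g (m + 1)) := by
  obtain ⟨h1, h2⟩ := h.invGapRatio_le
  refine (div_lt_one h1).mp (h2.trans_lt ?_)
  have := h.nonneg
  exact pow_lt_one₀ (by positivity) (h.four_mul_div_le.trans_lt (by norm_num)) (Nat.succ_ne_zero m)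

/-! ### Logarithms of the norms -/

/-- The constant is `4 + 2`: `2δ/ε` for the norm on the dominated vector, and `δ ≤ δ/ε` for passing
to the operator norm. -/
theorem abs_log_opNorm_comp_sub_le (i : ℕ) (hi : i + 1 ≤ m) :
    |Real.log (opNorm (g (i + 1) ∘ₗ g i)) -
        (Real.log (s (i + 1)) + Real.log |inner ℝ (v (i + 1)) (u i)| + Real.log (s i))| ≤
      6 * (κ / ε ^ 2) := by
  have hp := (h.isGapPair i (by omega)).adjoint
  have hp' := (h.isGapPair _ hi).adjoint
  have hd := hp.isDominant.mono h.le_two_mul_div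
  have hcomp := hd.comp hp.norm_left h.two_mul_div_nonneg hp'
    (h.transversality (h.le_inner' i hi))
  have h1 := hd.abs_norm_comp_sub_le hp.norm_left h.two_mul_div_nonneg hp'
  rw [hp.norm_map_left] at h1
  obtain ⟨h2, h3⟩ := abs_log_sub_le hp.pos hp'.pos h.pos (h.le_inner' i hi) h.two_mul_div_nonneg
    (by linarith [h.two_mul_div_le, h.pos]) h1
  have h4 := hcomp.abs_log_opNorm_sub_le hp'.norm_left h.two_mul_div_nonneg h2
  rw [← LinearMap.adjoint_comp, opNorm_adjoint] at h4
  rw [← LinearMap.adjoint_comp] at h3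
  have h5 : 2 * (κ / ε) ≤ 2 * (κ / ε) / ε :=
    le_div_self h.two_mul_div_nonneg h.pos h.lt_one.le
  have h6 : 2 * (κ / ε) / ε = 2 * (κ / ε ^ 2) := by
    have := h.pos.ne'
    field_simp
  rw [abs_le] at *
  constructor <;> linarith

theorem abs_log_norm_adjoint_chainProd_sub_le (i : ℕ) (hi : i + 1 ≤ m) :
    |Real.log ‖LinearMap.adjoint (chainProd g (i + 1 + 1)) (u (i + 1))‖ -
        (Real.log (s (i + 1)) + Real.log |inner ℝ (v (i + 1)) (u i)| +
          Real.log ‖LinearMap.adjoint (chainProd g (i + 1)) (u i)‖)| ≤ 4 * (κ / ε ^ 2) := by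
  obtain ⟨-, h2⟩ := abs_log_sub_le (h.norm_adjoint_chainProd_pos i (by omega))
    (h.isGapPair _ hi).pos h.pos (h.le_inner' i hi) h.two_mul_div_nonneg
    (by linarith [h.two_mul_div_le, h.pos]) (h.abs_norm_adjoint_chainProd_sub_le i hi)
  refine h2.trans (le_of_eq ?_)
  have := h.pos.ne'
  field_simp
  ring

/-- Subtracting the two-fold estimate from the recursion cancels `log s (i + 1)` and the angle,
leaving `-log (s i)` and an error `4 + 6 = 10`. The term `log (s 0)` compensates for sums that start
at `0`. -/
theorem abs_log_norm_adjoint_chainProd_add_sum_sub_sum_le : ∀ i ≤ m,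
    |Real.log ‖LinearMap.adjoint (chainProd g (i + 1)) (u i)‖ - Real.log (s 0)
        + ∑ k ∈ Finset.range i, Real.log (s k)
        - ∑ k ∈ Finset.range i, Real.log (opNorm (g (k + 1) ∘ₗ g k))| ≤
      10 * (i * (κ / ε ^ 2))
  | 0, _ => by
    rw [h.norm_adjoint_chainProd_zero]
    simp
  | i + 1, hi => by
    have h1 := abs_log_norm_adjoint_chainProd_add_sum_sub_sum_le i (by omega)
    have h2 := h.abs_log_norm_adjoint_chainProd_sub_le i hi
    have h3 := h.abs_log_opNorm_comp_sub_le i hi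
    rw [Finset.sum_range_succ, Finset.sum_range_succ]
    push_cast
    rw [abs_le] at *
    constructor <;> linarith

theorem abs_log_opNorm_chainProd_le (hm : 1 ≤ m) :
    |Real.log (opNorm (chainProd g (m + 1))) + ∑ i ∈ Finset.Ico 1 m, Real.log (opNorm (g i))
        - ∑ i ∈ Finset.range m, Real.log (opNorm (g (i + 1) ∘ₗ g i))| ≤
      10 * (((m : ℝ) + 1) * (κ / ε ^ 2)) := by
  have h1 := h.abs_log_norm_adjoint_chainProd_add_sum_sub_sum_le m le_rfl
  have h2 := (h.isDominant_adjoint_chainProd m le_rfl).abs_log_opNorm_sub_le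
    (h.isGapPair m le_rfl).norm_right h.two_mul_div_nonneg (h.norm_adjoint_chainProd_pos m le_rfl)
  rw [opNorm_adjoint] at h2
  have h3 : ∑ i ∈ Finset.Ico 1 m, Real.log (opNorm (g i)) =
      ∑ k ∈ Finset.range m, Real.log (s k) - Real.log (s 0) := by
    rw [Finset.range_eq_Ico, Finset.sum_eq_sum_Ico_succ_bot hm, add_sub_cancel_left]
    refine Finset.sum_congr rfl fun i hi => ?_
    rw [(h.isGapPair i (by have := Finset.mem_Ico.mp hi; omega)).opNorm_eq]
  have h4 : κ / ε ≤ κ / ε ^ 2 := by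
    have h0 := h.pos
    have h5 : ε ^ 2 ≤ ε := by nlinarith [h.lt_one]
    have h6 := h.nonneg
    gcongr
  have h5 := div_nonneg h.nonneg h.pos.le
  rw [h3]
  rw [abs_le] at *
  constructor <;> linarith

end IsGapChain

end Chain

/-- Unit singular vectors of a map with a first singular gap. -/
theorem HasFirstGap.exists_isGapPair {V W : Type*}
    [NormedAddCommGroup V] [InnerProductSpace ℝ V] [FiniteDimensional ℝ V]
    [NormedAddCommGroup W] [InnerProductSpace ℝ W] [FiniteDimensional ℝ W]
    {g : V →ₗ[ℝ] W} (h : HasFirstGap g) :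
    ∃ (v : V) (u : W), IsGapPair g v u (g.singularValues 0) (invGapRatio g) ∧
      v ∈ (mostExpandingDirection g h).submodule ∧
      u ∈ (mostExpandingDirection (LinearMap.adjoint g) h.adjoint).submodule := by
  obtain ⟨v, hv, hv1⟩ := h.exists_unit_mem
  have hp := h.isGapPair hv hv1
  exact ⟨v, _, hp, mem_submodule_mostExpandingDirection h hv,
    mem_submodule_mostExpandingDirection h.adjoint (hp.right_mem_topSingularSpace h)⟩

end Avalanche

/-! ### Assembly -/

theorem theorem4p1 :
    ∃ c : ℝ, 0 < c ∧ ∃ C : ℝ, 0 < C ∧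
      ∀ (ε κ : ℝ), 0 < ε → ε < 1 → 0 < κ → κ ≤ c * ε ^ 2 →
      -- a chain `g 0, …, g m` of `n = m + 1` linear maps `g j : V j → V (j + 1)`
      ∀ (m : ℕ) (V : ℕ → Type*)
        [∀ j, NormedAddCommGroup (V j)] [∀ j, InnerProductSpace ℝ (V j)]
        [∀ j, FiniteDimensional ℝ (V j)]
        (g : ∀ j, V j →ₗ[ℝ] V (j + 1))
        (hgap : ∀ i, i ≤ m → Avalanche.HasFirstGap (g i)),
        (∀ i, i ≤ m → Avalanche.invGapRatio (g i) ≤ κ) →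
        (∀ (i : ℕ) (hi : i + 1 ≤ m),
          ε ≤ Avalanche.mapAngle (g i) (g (i + 1))
            (hgap i ((Nat.le_succ i).trans hi)) (hgap (i + 1) hi)) →
        ∃ hprod : Avalanche.HasFirstGap (Avalanche.chainProd g (m + 1)),
          Avalanche.projDist
              (Avalanche.mostExpandingDirection (Avalanche.chainProd g (m + 1)) hprod)
              (Avalanche.mostExpandingDirection (g 0) (hgap 0 (Nat.zero_le m)))
            ≤ C * (κ / ε) ∧
          Avalanche.projDist
              (Avalanche.mostExpandingDirection
                (LinearMap.adjoint (Avalanche.chainProd g (m + 1))) hprod.adjoint)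
              (Avalanche.mostExpandingDirection
                (LinearMap.adjoint (g m)) (hgap m le_rfl).adjoint)
            ≤ C * (κ / ε) ∧
          Avalanche.invGapRatio (Avalanche.chainProd g (m + 1))
            ≤ (κ * (4 + 2 * ε) / ε ^ 2) ^ (m + 1) ∧
          (1 ≤ m →
            |Real.log (Avalanche.opNorm (Avalanche.chainProd g (m + 1)))
                + ∑ i ∈ Finset.Ico 1 m, Real.log (Avalanche.opNorm (g i))
                - ∑ i ∈ Finset.range m, Real.log (Avalanche.opNorm (g (i + 1) ∘ₗ g i))|
              ≤ C * (((m : ℝ) + 1) * (κ / ε ^ 2))) := by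

  -- `1 / 8` ensures `2κ/ε ≤ ε/4` and `4κ/ε² ≤ 1/2`. The logarithms require `10`; the directions
  -- need only `2δ = 4κ/ε`.
  refine ⟨1 / 8, by norm_num, 10, by norm_num, ?_⟩
  intro ε κ hε hε1 hκ hκε m V _ _ _ g hgap hσ hα
  have hex : ∀ i, ∃ (v : V i) (u : V (i + 1)), ∀ hi : i ≤ m,
      Avalanche.IsGapPair (g i) v u ((g i).singularValues 0) (Avalanche.invGapRatio (g i)) ∧
      v ∈ (Avalanche.mostExpandingDirection (g i) (hgap i hi)).submodule ∧
      u ∈ (Avalanche.mostExpandingDirection (LinearMap.adjoint (g i))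
        (hgap i hi).adjoint).submodule := by
    intro i
    by_cases hi : i ≤ m
    · obtain ⟨v, u, h⟩ := (hgap i hi).exists_isGapPair
      exact ⟨v, u, fun _ => h⟩
    -- Zero vectors are mere filler beyond `m`, where no gap is known.
    · exact ⟨0, 0, fun hi' => absurd hi' hi⟩
  choose v u hvu using hex
  have hκ1 : κ ≤ 1 := by nlinarith
  have h : Avalanche.IsGapChain g v u (fun i => (g i).singularValues 0) ε κ m :=
    { pos := hε
      lt_one := hε1
      nonneg := hκ.le
      le_sq := hκε
      isGapPair := fun i hi => (hvu i hi).1.mono (hσ i hi) hκ1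
      le_inner := fun i hi => by
        obtain ⟨h1, -, h2⟩ := hvu i ((Nat.le_succ i).trans hi)
        obtain ⟨h3, h4, -⟩ := hvu (i + 1) hi
        have := hα i hi
        rwa [Avalanche.mapAngle, Avalanche.projAngle_eq h2 h1.norm_right h4 h3.norm_left] at this }
  have hδ := div_nonneg hκ.le hε.le
  refine ⟨h.hasFirstGap, ?_, ?_, ?_, h.abs_log_opNorm_chainProd_le⟩
  · obtain ⟨h1, h2, -⟩ := hvu 0 (Nat.zero_le m)
    refine (h.isDominant_chainProd.projDist_le h1.norm_left h.two_mul_div_nonneg _ h2).trans ?_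
    linarith
  · obtain ⟨h1, -, h2⟩ := hvu m le_rfl
    refine ((h.isDominant_adjoint_chainProd m le_rfl).projDist_le h1.norm_right
      h.two_mul_div_nonneg _ h2).trans ?_
    linarith
  · refine h.invGapRatio_le.2.trans ?_
    have : 4 * κ ≤ κ * (4 + 2 * ε) := by nlinarith
    gcongr
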